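/- Let $X$ be a real reflexive Banach space, $K\subset X$ closed and convex with $0\in K$, $X_j$ a real Banach space, $Y$ a real normed space, and write $\langle\cdot,\cdot\rangle$ for the duality pairing of $X^*$ and $X$. For a locally Lipschitz function $\phi$ on a normed space $E$, let $$\phi^0(x;v)=\limsup_{y\to x,\ \lambda\downarrow 0}\frac{\phi(y+\lambda v)-\phi(y)}{\lambda},\qquad \partial\phi(x)=\{\xi\in E^*\mid \phi^0(x;v)\ge \langle\xi,v\rangle_{E^*\times E}\ \ \forall\,v\in E\}$$ be its Clarke directional derivative and Clarke subdifferential. Assume the following. (1) $\gamma_j\in\mathcal L(X;X_j)$ and $c_j>0$ satisfy $\|\gamma_jv\|_{X_j}\le c_j\|v\|_X$ for all $v\in X$. (2) $A:X\to X^*$ is Lipschitz continuous with a constant $L_A>0$, and there is $m_A>0$ with $\langle Av_1-Av_2,v_1-v_2\rangle\ge m_A\|v_1-v_2\|_X^2$ for all $v_1,v_2\in X$. (3) $\varphi:Y\times K\times K\to\mathbb R$ is such that $\varphi(y,u,\cdot)$ is convex and lower semicontinuous on $K$ for all $y\in Y$, $u\in K$, and there are $\alpha_\varphi,\beta_\varphi>0$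 such that for all $y_1,y_2\in Y$ and $u_1,u_2,v_1,v_2\in K$, $$\varphi(y_1,u_1,v_2)-\varphi(y_1,u_1,v_1)+\varphi(y_2,u_2,v_1)-\varphi(y_2,u_2,v_2)\le\alpha_\varphi\|u_1-u_2\|_X\|v_1-v_2\|_X+\beta_\varphi\|y_1-y_2\|_Y\|v_1-v_2\|_X.$$ (4) $j:X_j\to\mathbb R$ is locally Lipschitz; there are $c_0,c_1\ge0$ with $\|\xi\|_{X_j^*}\le c_0+c_1\|z\|_{X_j}$ for all $z\in X_j$, $\xi\in\partial j(z)$; and there is $\alpha_j>0$ with $j^0(z_1;z_2-z_1)+j^0(z_2;z_1-z_2)\le\alpha_j\|z_1-z_2\|_{X_j}^2$ for all $z_1,z_2\in X_j$. (5) $f\in C(\mathbb R_+;X^*)$, where $\mathbb R_+=[0,\infty)$. (6) $\alpha_\varphi+\alpha_jc_j^2<m_A$. (7) $R\in\mathcal L(X;Y)$, $q\in C(\mathbb R_+\times\mathbb R_+;\mathcal L(X))$, $a_S\in X$; these define the history-dependent operator $(\mathcal Sv)(t)=R\big(\int_0^tq(t,s)v(s)\,ds+a_S\big)$, $v\in C(\mathbb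 R_+;X)$. Let $T\ge0$, let $N\ge1$ be an integer, and put $k=T/N$, $t_n=nk$, $f_n=f(t_n)$ for $0\le n\le N$. For $v=(v_0,\dots,v_N)\in X^{N+1}$, approximate $\mathcal S$ at $t_n$ by the modified trapezoidal rule $$\mathcal S_{n,L}^kv=R\Big(\frac k2\,q(t_n,t_0)v_0+k\sum_{i=1}^{n-1}q(t_n,t_i)v_i+\frac k2\,q(t_n,t_{n-1})v_{n-1}+a_S\Big)\quad(1\le n\le N),\qquad \mathcal S_{0,L}^kv=R\,a_S.$$ Then, for every such $T$ and $N$ (so without any restriction on the step size $k$), there is exactly one $u^k=(u_0^k,\dots,u_N^k)$ with all $u_n^k\in K$ such that, for every $0\le n\le N$ and every $v\in K$, $$\langle Au_n^k,v-u_n^k\rangle+\varphi(\mathcal S_{n,L}^ku^k,u_n^k,v)-\varphi(\mathcal S_{n,L}^ku^k,u_n^k,u_n^k)+j^0(\gamma_ju_n^k;\gamma_jv-\gamma_ju_n^k)\ge\langle f_n,v-u_n^k\rangle.$$ -/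

import Mathlib

open Set Filter Topology
open scoped NNReal

noncomputable section

/-- The generalized (Clarke) directional derivative
`φ⁰(x; v) = limsup_{y → x, λ ↓ 0} (φ (y + λ v) - φ y) / λ`.
It is meant for locally Lipschitz `φ`: the difference quotients are then bounded near
`y = x`, `λ = 0+`, so the upper limit in `ℝ` is the true one. -/
def clarkeDeriv {E : Type*} [NormedAddCommGroup E] [NormedSpace ℝ E]
    (φ : E → ℝ) (x v : E) : ℝ :=
  limsup (fun p : E × ℝ => (φ (p.1 + p.2 • v) - φ p.1) / p.2) (𝓝 x ×ˢ 𝓝[>] (0 : ℝ))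

/-- The generalized (Clarke) gradient `∂φ(x) ⊆ E*`. -/
def clarkeSubdiff {E : Type*} [NormedAddCommGroup E] [NormedSpace ℝ E]
    (φ : E → ℝ) (x : E) : Set (StrongDual ℝ E) :=
  {ξ | ∀ v : E, ξ v ≤ clarkeDeriv φ x v}

/-- Reflexivity of a normed space: the canonical embedding into the bidual is onto. -/
def IsReflexiveSpace (E : Type*) [NormedAddCommGroup E] [NormedSpace ℝ E] : Prop :=
  Function.Surjective (NormedSpace.inclusionInDoubleDual ℝ E)

/-- The time step `k = T / N`. -/
def timeStep (T : ℝ≥0) (N : ℕ) : ℝ≥0 := T / N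

/-- The nodes `t_n = n k`, `0 ≤ n ≤ N`, of the uniform partition of `[0, T]`. -/
def timeNode (T : ℝ≥0) (N : ℕ) (n : Fin (N + 1)) : ℝ≥0 := (n : ℕ) * timeStep T N

/-- The modified trapezoidal approximation at `t_n` of
`(S v)(t) = R (∫₀ᵗ q(t, s) v(s) ds + a_S)`:
the trapezoidal rule with the last nodal value `q(t_n, t_n) v_n` replaced by
`q(t_n, t_{n-1}) v_{n-1}`, i.e. for `n ≥ 1`
`R (k/2 q(t_n, t_0) v_0 + k ∑_{0 < i < n} q(t_n, t_i) v_i + k/2 q(t_n, t_{n-1}) v_{n-1} + a_S)`.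
For `n = 0` the integral over `[0, t_0] = {0}` is absent and the value is `R a_S`. -/
def historyApprox {X Y : Type*} [NormedAddCommGroup X] [NormedSpace ℝ X]
    [NormedAddCommGroup Y] [NormedSpace ℝ Y]
    (R : X →L[ℝ] Y) (q : C(ℝ≥0 × ℝ≥0, X →L[ℝ] X)) (aS : X) (T : ℝ≥0) (N : ℕ)
    (n : Fin (N + 1)) (v : Fin (N + 1) → X) : Y :=
  if n = 0 then R aS
  else
    R (((timeStep T N : ℝ) / 2) • q (timeNode T N n, timeNode T N 0) (v 0)
      + (timeStep T N : ℝ) • ∑ i ∈ Finset.Ioo 0 n, q (timeNode T N n, timeNode T N i) (v i)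
      + ((timeStep T N : ℝ) / 2) • q (timeNode T N n, timeNode T N (n - 1)) (v (n - 1))
      + aS)

/-- `u = (u_0, …, u_N)` solves the second-order semi-discrete scheme: every `u_n` lies in `K`
and satisfies the variational-hemivariational inequality at the node `t_n`, the history term
being evaluated by `historyApprox`. -/
def IsSemiDiscreteSolution {X Xj Y : Type*} [NormedAddCommGroup X] [NormedSpace ℝ X]
    [NormedAddCommGroup Xj] [NormedSpace ℝ Xj] [NormedAddCommGroup Y] [NormedSpace ℝ Y]
    (K : Set X) (γ : X →L[ℝ] Xj) (A : X → StrongDual ℝ X) (φ : Y → X → X → ℝ)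
    (j : Xj → ℝ) (f : C(ℝ≥0, StrongDual ℝ X))
    (R : X →L[ℝ] Y) (q : C(ℝ≥0 × ℝ≥0, X →L[ℝ] X)) (aS : X) (T : ℝ≥0) (N : ℕ)
    (u : Fin (N + 1) → X) : Prop :=
  ∀ n : Fin (N + 1), u n ∈ K ∧ ∀ v ∈ K,
    f (timeNode T N n) (v - u n) ≤
      A (u n) (v - u n)
        + φ (historyApprox R q aS T N n u) (u n) v
        - φ (historyApprox R q aS T N n u) (u n) (u n)
        + clarkeDeriv j (γ (u n)) (γ v - γ (u n))

end

/-! The modified rule uses only `v i` with `i < n`, so at step `n` the history argument of `φ` is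
already known and each step is a stationary inequality. No smallness of the step size is needed to
absorb an implicit history term.

The stationary inequality (`existsUnique_vhi`) is an equilibrium problem `0 ≤ F u v` whose
bifunction is strongly monotone with constant `mA - (α + αj * cj ^ 2) > 0`; this gives uniqueness.
Existence (`IsReflexiveSpace.exists_equilibrium`) is Minty's method: finitely many Minty sets meet
by a minimax argument, weak compactness gives a point common to all, and hemicontinuity turns it
into an equilibrium. -/

/-! ### Calculus of the Clarke directional derivative -/

section Clarke

variable {E : Type*} [NormedAddCommGroup E] [NormedSpace ℝ E] {φ : E → ℝ} {x : E}

lemma tendsto_add_smul_clarke (x v : E) :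
    Tendsto (fun p : E × ℝ => p.1 + p.2 • v) (𝓝 x ×ˢ 𝓝[>] (0 : ℝ)) (𝓝 x) := by
  have h1 : Tendsto (fun p : E × ℝ => p.1) (𝓝 x ×ˢ 𝓝[>] (0 : ℝ)) (𝓝 x) := tendsto_fst
  have h2 : Tendsto (fun p : E × ℝ => p.2) (𝓝 x ×ˢ 𝓝[>] (0 : ℝ)) (𝓝 0) :=
    tendsto_nhds_of_tendsto_nhdsWithin tendsto_snd
  simpa using h1.add (h2.smul_const v)

lemma eventually_pos_clarke {E : Type*} [NormedAddCommGroup E] (x : E) : ∀ᶠ p in 𝓝 x ×ˢ 𝓝[>] (0 : ℝ), 0 < p.2 :=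
  tendsto_snd.eventually self_mem_nhdsWithin

/-- The difference quotients of a locally Lipschitz function are locally bounded. -/
lemma LocallyLipschitz.eventually_abs_quotient_le (hφ : LocallyLipschitz φ) (x : E) :
    ∃ C : ℝ, 0 ≤ C ∧ ∀ v : E, ∀ᶠ p in 𝓝 x ×ˢ 𝓝[>] (0 : ℝ),
      |(φ (p.1 + p.2 • v) - φ p.1) / p.2| ≤ C * ‖v‖ := by
  obtain ⟨C, t, ht, hC⟩ := hφ x
  refine ⟨C, C.2, fun v => ?_⟩
  filter_upwards [eventually_pos_clarke x, (tendsto_add_smul_clarke x v).eventually ht,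
    tendsto_fst.eventually ht] with p hp h1 h2
  rw [abs_div, abs_of_pos hp, div_le_iff₀ hp]
  have := hC.dist_le_mul _ h1 _ h2
  rw [Real.dist_eq, dist_eq_norm, add_sub_cancel_left, norm_smul, Real.norm_of_nonneg hp.le] at this
  linarith

lemma clarkeDeriv_le_of_eventually (hφ : LocallyLipschitz φ) {v : E} {a : ℝ}
    (h : ∀ᶠ p in 𝓝 x ×ˢ 𝓝[>] (0 : ℝ), (φ (p.1 + p.2 • v) - φ p.1) / p.2 ≤ a) :
    clarkeDeriv φ x v ≤ a := by
  obtain ⟨C, -, hC⟩ := hφ.eventually_abs_quotient_le x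
  refine limsup_le_of_le (IsBoundedUnder.isCoboundedUnder_le ⟨-(C * ‖v‖), ?_⟩) h
  exact (hC v).mono fun p hp => (abs_le.1 hp).1

lemma eventually_lt_of_clarkeDeriv_lt (hφ : LocallyLipschitz φ) {v : E} {a : ℝ}
    (h : clarkeDeriv φ x v < a) :
    ∀ᶠ p in 𝓝 x ×ˢ 𝓝[>] (0 : ℝ), (φ (p.1 + p.2 • v) - φ p.1) / p.2 < a := by
  obtain ⟨C, -, hC⟩ := hφ.eventually_abs_quotient_le x
  refine eventually_lt_of_limsup_lt h ⟨C * ‖v‖, ?_⟩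
  exact (hC v).mono fun p hp => (abs_le.1 hp).2

lemma exists_abs_clarkeDeriv_le (hφ : LocallyLipschitz φ) (x : E) :
    ∃ C : ℝ, 0 ≤ C ∧ ∀ v : E, |clarkeDeriv φ x v| ≤ C * ‖v‖ := by
  obtain ⟨C, hC0, hC⟩ := hφ.eventually_abs_quotient_le x
  refine ⟨C, hC0, fun v => abs_le.2 ⟨?_, ?_⟩⟩
  · refine le_limsup_of_le ⟨C * ‖v‖, (hC v).mono fun p hp => (abs_le.1 hp).2⟩ fun b hb => ?_
    obtain ⟨p, hp, hp'⟩ := ((hC v).and hb).exists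
    exact (abs_le.1 hp).1.trans hp'
  · exact clarkeDeriv_le_of_eventually hφ ((hC v).mono fun p hp => (abs_le.1 hp).2)

lemma clarkeDeriv_zero (hφ : LocallyLipschitz φ) (x : E) : clarkeDeriv φ x 0 = 0 := by
  obtain ⟨C, -, hC⟩ := exists_abs_clarkeDeriv_le hφ x
  simpa using hC 0

/-- The quotient in direction `v + w` splits at the shifted base point `y + λ • w`, which still
tends to `x`. -/
lemma clarkeDeriv_add_le (hφ : LocallyLipschitz φ) (x v w : E) :
    clarkeDeriv φ x (v + w) ≤ clarkeDeriv φ x v + clarkeDeriv φ x w := by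
  refine le_of_forall_pos_le_add fun ε hε => clarkeDeriv_le_of_eventually hφ ?_
  have h1 := eventually_lt_of_clarkeDeriv_lt hφ
    (show clarkeDeriv φ x v < clarkeDeriv φ x v + ε / 2 by linarith)
  have h2 := eventually_lt_of_clarkeDeriv_lt hφ
    (show clarkeDeriv φ x w < clarkeDeriv φ x w + ε / 2 by linarith)
  have h3 : Tendsto (fun p : E × ℝ => (p.1 + p.2 • w, p.2)) (𝓝 x ×ˢ 𝓝[>] (0 : ℝ))
      (𝓝 x ×ˢ 𝓝[>] (0 : ℝ)) := (tendsto_add_smul_clarke x w).prodMk tendsto_snd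
  filter_upwards [h3.eventually h1, h2] with p hp1 hp2
  have e : p.1 + p.2 • (v + w) = p.1 + p.2 • w + p.2 • v := by rw [smul_add]; abel
  have e2 : (φ (p.1 + p.2 • (v + w)) - φ p.1) / p.2
      = (φ (p.1 + p.2 • w + p.2 • v) - φ (p.1 + p.2 • w)) / p.2
        + (φ (p.1 + p.2 • w) - φ p.1) / p.2 := by rw [e]; ring
  linarith

lemma clarkeDeriv_smul_le (hφ : LocallyLipschitz φ) (x v : E) {t : ℝ} (ht : 0 ≤ t) :
    clarkeDeriv φ x (t • v) ≤ t * clarkeDeriv φ x v := by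
  rcases ht.eq_or_lt with rfl | ht
  · simp [clarkeDeriv_zero hφ]
  refine le_of_forall_pos_le_add fun ε hε => clarkeDeriv_le_of_eventually hφ ?_
  have h1 := eventually_lt_of_clarkeDeriv_lt hφ
    (show clarkeDeriv φ x v < clarkeDeriv φ x v + ε / t by have := div_pos hε ht; linarith)
  have h2 : Tendsto (fun s : ℝ => s * t) (𝓝[>] 0) (𝓝[>] 0) := by
    refine tendsto_nhdsWithin_iff.2 ⟨?_, ?_⟩
    · have : Tendsto (fun s : ℝ => s * t) (𝓝 0) (𝓝 (0 * t)) := tendsto_id.mul_const t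
      rw [zero_mul] at this
      exact this.mono_left nhdsWithin_le_nhds
    · filter_upwards [self_mem_nhdsWithin] with s hs using mul_pos hs ht
  have h3 : Tendsto (fun p : E × ℝ => (p.1, p.2 * t)) (𝓝 x ×ˢ 𝓝[>] (0 : ℝ))
      (𝓝 x ×ˢ 𝓝[>] (0 : ℝ)) := tendsto_fst.prodMk (h2.comp tendsto_snd)
  filter_upwards [h3.eventually h1, eventually_pos_clarke x] with p hp1 hp
  have e : (φ (p.1 + p.2 • t • v) - φ p.1) / p.2
      = t * ((φ (p.1 + (p.2 * t) • v) - φ p.1) / (p.2 * t)) := by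
    rw [smul_smul]; field_simp
  rw [e]
  refine (mul_le_mul_of_nonneg_left hp1.le ht.le).trans (le_of_eq ?_)
  field_simp

/-- The Clarke derivative is upper semicontinuous in the base point. -/
lemma upperSemicontinuous_clarkeDeriv (hφ : LocallyLipschitz φ) (v : E) :
    UpperSemicontinuous fun x => clarkeDeriv φ x v := by
  intro x a ha
  obtain ⟨b, hb, hba⟩ := exists_between ha
  -- A bound valid for base points near `x` is valid near every `y` close to `x`.
  obtain ⟨p, hp, r, hr, hpr⟩ := eventually_prod_iff.1 (eventually_lt_of_clarkeDeriv_lt hφ hb)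
  filter_upwards [eventually_eventually_nhds.2 hp] with y hy
  refine (clarkeDeriv_le_of_eventually hφ ?_).trans_lt hba
  exact eventually_prod_iff.2 ⟨p, hy, r, hr, fun hx _ hz => (hpr hx hz).le⟩

lemma convexOn_clarkeDeriv (hφ : LocallyLipschitz φ) (x : E) :
    ConvexOn ℝ univ (clarkeDeriv φ x) :=
  ⟨convex_univ, fun v _ w _ _ _ ha hb _ => (clarkeDeriv_add_le hφ x _ _).trans
    (add_le_add (clarkeDeriv_smul_le hφ x v ha) (clarkeDeriv_smul_le hφ x w hb))⟩

lemma continuous_clarkeDeriv (hφ : LocallyLipschitz φ) (x : E) :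
    Continuous (clarkeDeriv φ x) := by
  obtain ⟨C, hC0, hC⟩ := exists_abs_clarkeDeriv_le hφ x
  refine (LipschitzWith.of_le_add_mul ⟨C, hC0⟩ fun v w => ?_).continuous
  have h1 := clarkeDeriv_add_le hφ x w (v - w)
  rw [add_sub_cancel] at h1
  have h2 := (abs_le.1 (hC (v - w))).2
  rw [dist_eq_norm]
  change _ ≤ _ + C * _
  linarith

end Clarke

/-! ### Equilibrium problems in reflexive spaces -/

section Equilibrium

/-- A real matrix with `a i k + a k i ≤ 0` has a vector of weights on which it is nonpositive. -/
lemma exists_mem_stdSimplex_forall_sum_nonpos {ι : Type*} [Fintype ι] [Nonempty ι]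
    (a : ι → ι → ℝ) (ha : ∀ i k, a i k + a k i ≤ 0) :
    ∃ w ∈ stdSimplex ℝ ι, ∀ i, ∑ k, w k * a i k ≤ 0 := by
  classical
  let B : (ι → ℝ) →ₗ[ℝ] (ι → ℝ) →ₗ[ℝ] ℝ := (Matrix.toLinearMap₂' ℝ (Matrix.of a)).flip
  have hB (w μ : ι → ℝ) : B w μ = ∑ i, ∑ k, μ i * (w k * a i k) := by
    simp only [B, LinearMap.flip_apply, Matrix.toLinearMap₂'_apply, Matrix.of_apply, smul_eq_mul]
  have hc1 (w : ι → ℝ) : Continuous fun μ => B w μ := LinearMap.continuous_of_finiteDimensional _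
  have hc2 (μ : ι → ℝ) : Continuous fun w => B w μ :=
    LinearMap.continuous_of_finiteDimensional (B.flip μ)
  have hne : (stdSimplex ℝ ι).Nonempty := ⟨_, single_mem_stdSimplex ℝ (Classical.arbitrary ι)⟩
  have hcv := convex_stdSimplex ℝ ι
  obtain ⟨w, hw, μ, hμ, h⟩ := Sion.exists_isSaddlePointOn (X := stdSimplex ℝ ι)
    (Y := stdSimplex ℝ ι) (f := fun w μ => B w μ) hne hcv (isCompact_stdSimplex ℝ ι)
    (fun μ _ => (hc2 μ).lowerSemicontinuous.lowerSemicontinuousOn _)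
    (fun μ _ => ((B.flip μ).convexOn hcv).quasiconvexOn)
    hcv hne (isCompact_stdSimplex ℝ ι)
    (fun w _ => (hc1 w).upperSemicontinuous.upperSemicontinuousOn _)
    (fun w _ => ((B w).concaveOn hcv).quasiconcaveOn)
  refine ⟨w, hw, fun i => ?_⟩
  -- The saddle inequality is tested at `μ` itself; symmetrizing `a` then shows `B μ μ ≤ 0`.
  have h1 : B w (Pi.single i 1) ≤ B μ μ := h μ hμ _ (single_mem_stdSimplex ℝ i)
  have h2 : B w (Pi.single i 1) = ∑ k, w k * a i k := by
    rw [hB, Finset.sum_eq_single i]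
    · simp
    · intro l _ hl; simp [hl]
    · simp
  have h3 : B μ μ + B μ μ ≤ 0 := by
    rw [hB]
    nth_rewrite 2 [Finset.sum_comm]
    rw [← Finset.sum_add_distrib]
    refine Finset.sum_nonpos fun i _ => ?_
    rw [← Finset.sum_add_distrib]
    refine Finset.sum_nonpos fun k _ => ?_
    have := mul_nonpos_of_nonneg_of_nonpos (mul_nonneg (hμ.1 i) (hμ.1 k)) (ha i k)
    linarith
  linarith

variable {X : Type*} [NormedAddCommGroup X] [NormedSpace ℝ X]

/-- Mazur's theorem: for convex sets, norm and weak closures coincide. -/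
lemma IsClosed.toWeakSpace_image {s : Set X} (hs : IsClosed s) (hc : Convex ℝ s) :
    IsClosed (toWeakSpace ℝ X '' s) := by
  have := hc.toWeakSpace_closure ℝ
  rw [hs.closure_eq] at this
  rw [this]
  exact isClosed_closure

lemma IsReflexiveSpace.isCompact_toWeakSpace_image (hX : IsReflexiveSpace X) {s : Set X}
    (hs : IsClosed s) (hc : Convex ℝ s) (hb : Bornology.IsBounded s) :
    IsCompact (toWeakSpace ℝ X '' s) := by
  rw [← (hs.toWeakSpace_image hc).closure_eq]
  refine NormedSpace.isCompact_closure_of_isBounded ℝ X _ ?_ ?_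
  · rwa [preimage_image_eq _ (toWeakSpace ℝ X).injective]
  · intro y _
    obtain ⟨x, hx⟩ := hX (WeakDual.toStrongDual y)
    refine ⟨toWeakSpace ℝ X x, ?_⟩
    exact DFunLike.ext _ _ fun g => DFunLike.congr_fun hx g

/-- In a reflexive space, closed convex sets with the finite intersection property, one of them
bounded, have a common point. -/
lemma IsReflexiveSpace.nonempty_iInter (hX : IsReflexiveSpace X) {ι : Type*} (s : ι → Set X)
    (hs : ∀ i, IsClosed (s i)) (hc : ∀ i, Convex ℝ (s i)) (i₀ : ι)
    (hb : Bornology.IsBounded (s i₀))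
    (hfin : ∀ t : Finset ι, i₀ ∈ t → (⋂ i ∈ t, s i).Nonempty) : (⋂ i, s i).Nonempty := by
  classical
  obtain ⟨z, -, hz⟩ := (hX.isCompact_toWeakSpace_image (hs i₀) (hc i₀) hb).inter_iInter_nonempty
    (fun i => toWeakSpace ℝ X '' s i) (fun i => (hs i).toWeakSpace_image (hc i)) (fun t => by
      obtain ⟨x, hx⟩ := hfin (insert i₀ t) (Finset.mem_insert_self _ _)
      simp only [mem_iInter] at hx
      refine ⟨toWeakSpace ℝ X x, mem_image_of_mem _ (hx _ (Finset.mem_insert_self _ _)), ?_⟩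
      simp only [mem_iInter]
      exact fun i hi => mem_image_of_mem _ (hx _ (Finset.mem_insert_of_mem hi)))
  refine ⟨(toWeakSpace ℝ X).symm z, mem_iInter.2 fun i => ?_⟩
  obtain ⟨x, hx, rfl⟩ := mem_iInter.1 hz i
  simpa using hx

/-- Sublevel sets of a lower semicontinuous convex function plus a coercive quadratic term are
bounded. -/
lemma isBounded_sublevel_add_sq {K : Set X} {g : X → ℝ} (hg : ConvexOn ℝ K g)
    (hlsc : LowerSemicontinuousOn g K) {v : X} (hv : v ∈ K) (hgv : g v = 0) {c : ℝ} (hc : 0 < c) :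
    Bornology.IsBounded {u ∈ K | g u + c * ‖u - v‖ ^ 2 ≤ 0} := by
  have h := hlsc v hv (-1) (show -1 < g v by rw [hgv]; norm_num)
  obtain ⟨r, hr, hball⟩ := Metric.mem_nhdsWithin_iff.1 h
  refine (Metric.isBounded_closedBall (x := v) (r := max r (2 / (c * r)))).subset ?_
  rintro u ⟨hu, hle⟩
  rw [mem_closedBall_iff_norm]
  set d := ‖u - v‖ with hd
  rcases le_or_gt d r with hdr | hdr
  · exact hdr.trans (le_max_left _ _)
  refine le_trans ?_ (le_max_right _ _)
  have hd0 : 0 < d := hr.trans hdr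
  -- The point at parameter `t` lies at distance `r / 2` from `v`, where `g > -1`. Convexity gives
  -- `-1 < t * g u ≤ -t * c * d ^ 2`, hence `d < 2 / (c * r)`.
  set t := r / (2 * d) with ht
  have ht0 : 0 < t := by positivity
  have ht1 : t ≤ 1 := by rw [ht, div_le_one (by positivity)]; linarith
  have htd : t * d = r / 2 := by rw [ht]; field_simp
  have hw := hg.2 hv hu (sub_nonneg.2 ht1) ht0.le (by ring)
  have hwK := hg.1 hv hu (sub_nonneg.2 ht1) ht0.le (by ring)
  have hwb : (1 - t) • v + t • u ∈ Metric.ball v r := by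
    rw [mem_ball_iff_norm]
    have : (1 - t) • v + t • u - v = t • (u - v) := by module
    rw [this, norm_smul, Real.norm_of_nonneg ht0.le, ← hd, htd]
    linarith
  have h1 : -1 < g ((1 - t) • v + t • u) := hball ⟨hwb, hwK⟩
  rw [hgv, smul_zero, zero_add, smul_eq_mul] at hw
  have h2 : t * (c * d ^ 2) < 1 := by nlinarith
  rw [le_div_iff₀ (by positivity)]
  have h3 : t * (c * d ^ 2) = c * d * (t * d) := by ring
  rw [h3, htd] at h2
  linarith

/-- Solvability of an equilibrium problem with a strongly monotone bifunction that is convex and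
lower semicontinuous in the second and hemicontinuous in the first variable. -/
theorem IsReflexiveSpace.exists_equilibrium (hX : IsReflexiveSpace X) {K : Set X}
    (hK : IsClosed K) (hne : K.Nonempty) {F : X → X → ℝ} {c : ℝ} (hc : 0 < c)
    (hdiag : ∀ u ∈ K, F u u = 0)
    (hmono : ∀ u ∈ K, ∀ v ∈ K, F u v + F v u ≤ -c * ‖u - v‖ ^ 2)
    (hconv : ∀ u ∈ K, ConvexOn ℝ K (F u))
    (hlsc : ∀ u ∈ K, LowerSemicontinuousOn (F u) K)
    (hhemi : ∀ u ∈ K, ∀ v ∈ K, ∀ a, F u v < a →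
      ∀ᶠ t in 𝓝[>] (0 : ℝ), F ((1 - t) • u + t • v) v < a) :
    ∃ u ∈ K, ∀ v ∈ K, 0 ≤ F u v := by
  obtain ⟨v₀, hv₀⟩ := hne
  -- Half of `c` goes to each of `F u v` and `F v u`: then `G v u + G u v ≤ 0`, and the quadratic
  -- term bounds the sublevel sets.
  let G : X → X → ℝ := fun v u => F v u + c / 2 * ‖u - v‖ ^ 2
  have hGconv (v) (hv : v ∈ K) : ConvexOn ℝ K (G v) := by
    refine (hconv v hv).add (ConvexOn.smul (by positivity) ?_)
    have h1 : ConvexOn ℝ K fun u : X => ‖u - v‖ := by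
      simpa [dist_eq_norm] using convexOn_dist v (hconv v hv).1
    exact h1.pow (fun _ _ => norm_nonneg _) 2
  have hGlsc (v) (hv : v ∈ K) : LowerSemicontinuousOn (G v) K :=
    (hlsc v hv).add <| Continuous.lowerSemicontinuous
      (show Continuous fun u => c / 2 * ‖u - v‖ ^ 2 by fun_prop) |>.lowerSemicontinuousOn K
  obtain ⟨u, hu⟩ : (⋂ v : K, {u ∈ K | G v u ≤ 0}).Nonempty := by
    refine hX.nonempty_iInter _ (fun v => ?_) (fun v => (hGconv v v.2).convex_le 0) ⟨v₀, hv₀⟩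
      (isBounded_sublevel_add_sq (hconv v₀ hv₀) (hlsc v₀ hv₀) hv₀ (hdiag v₀ hv₀) (half_pos hc))
      fun t ht => ?_
    · obtain ⟨s, hs, h⟩ := lowerSemicontinuousOn_iff_preimage_Iic.1 (hGlsc v v.2) 0
      have : {u ∈ K | G v u ≤ 0} = K ∩ s := h
      rw [this]
      exact hK.inter hs
    · have : Nonempty t := ⟨⟨_, ht⟩⟩
      obtain ⟨w, hw, h⟩ := exists_mem_stdSimplex_forall_sum_nonpos
        (fun i k : t => G i k) fun i k => by
          have := hmono i i.1.2 k k.1.2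
          simp only [G]
          rw [norm_sub_rev (k : X) (i : X)]
          linarith
      refine ⟨∑ k, w k • (k : X), ?_⟩
      simp only [mem_iInter]
      intro i hi
      exact ⟨(hconv v₀ hv₀).1.sum_mem (fun k _ => hw.1 k) hw.2 fun k _ => k.1.2,
        ((hGconv i i.2).map_sum_le (fun k _ => hw.1 k) hw.2 fun k _ => k.1.2).trans (h ⟨i, hi⟩)⟩
  simp only [mem_iInter] at hu
  have huK : u ∈ K := (hu ⟨v₀, hv₀⟩).1
  refine ⟨u, huK, fun v hv => ?_⟩
  by_contra! hneg
  -- Minty's trick: for `w = (1 - t) • u + t • v`, convexity gives `0 = F w w ≤ (1 - t) * F w u + t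
  -- * F w v`, but `F w u ≤ 0` and `F w v < 0`.
  obtain ⟨t, ht, ht1, ht0⟩ := ((hhemi u huK v hv 0 hneg).and
    (Ioo_mem_nhdsGT (zero_lt_one' ℝ))).exists
  have hw := (hconv u huK).1 huK hv (sub_nonneg.2 ht0.le) ht1.le (by ring)
  have h1 := (hconv _ hw).2 huK hv (sub_nonneg.2 ht0.le) ht1.le (by ring)
  rw [hdiag _ hw] at h1
  have h2 : F ((1 - t) • u + t • v) u ≤ 0 := by
    have := (hu ⟨_, hw⟩).2
    simp only [G] at this
    have := mul_nonneg (half_pos hc).le (sq_nonneg ‖u - ((1 - t) • u + t • v)‖)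
    linarith
  have h3 := mul_nonpos_of_nonneg_of_nonpos (sub_nonneg.2 ht0.le) h2
  have h4 := mul_neg_of_pos_of_neg ht1 ht
  simp only [smul_eq_mul] at h1
  linarith

end Equilibrium

/-! ### The stationary variational-hemivariational inequality -/

section VariationalHemivariational

variable {X Xj : Type*} [NormedAddCommGroup X] [NormedSpace ℝ X]
  [NormedAddCommGroup Xj] [NormedSpace ℝ Xj]

/-- The bifunction whose equilibria solve the variational-hemivariational inequality. -/
noncomputable def vhiBifunction (γ : X →L[ℝ] Xj) (A : X → StrongDual ℝ X) (ψ : X → X → ℝ) (j : Xj → ℝ)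
    (g : StrongDual ℝ X) (u v : X) : ℝ :=
  A u (v - u) + ψ u v - ψ u u + clarkeDeriv j (γ u) (γ v - γ u) - g (v - u)

variable {K : Set X} {γ : X →L[ℝ] Xj} {A : X → StrongDual ℝ X} {ψ : X → X → ℝ} {j : Xj → ℝ}
  {cj mA α αj : ℝ}

lemma vhiBifunction_self (hj : LocallyLipschitz j) (g : StrongDual ℝ X) (u : X) :
    vhiBifunction γ A ψ j g u u = 0 := by
  simp [vhiBifunction, clarkeDeriv_zero hj]

lemma vhiBifunction_strongly_monotone (hγ : ∀ v : X, ‖γ v‖ ≤ cj * ‖v‖)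
    (hA : ∀ v₁ v₂ : X, mA * ‖v₁ - v₂‖ ^ 2 ≤ (A v₁ - A v₂) (v₁ - v₂))
    (hψ : ∀ u₁ ∈ K, ∀ u₂ ∈ K, ∀ v₁ ∈ K, ∀ v₂ ∈ K,
      ψ u₁ v₂ - ψ u₁ v₁ + ψ u₂ v₁ - ψ u₂ v₂ ≤ α * ‖u₁ - u₂‖ * ‖v₁ - v₂‖)
    (hαj : 0 ≤ αj)
    (hj : ∀ z₁ z₂ : Xj,
      clarkeDeriv j z₁ (z₂ - z₁) + clarkeDeriv j z₂ (z₁ - z₂) ≤ αj * ‖z₁ - z₂‖ ^ 2)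
    (g : StrongDual ℝ X) {u v : X} (hu : u ∈ K) (hv : v ∈ K) :
    vhiBifunction γ A ψ j g u v + vhiBifunction γ A ψ j g v u
      ≤ -(mA - (α + αj * cj ^ 2)) * ‖u - v‖ ^ 2 := by
  have h1 := hA u v
  have h2 := hψ u hu v hv u hu v hv
  have h3 := hj (γ u) (γ v)
  have h4 : αj * ‖γ u - γ v‖ ^ 2 ≤ αj * (cj * ‖u - v‖) ^ 2 := by
    have := hγ (u - v)
    rw [map_sub] at this
    gcongr
  have h5 : (A u - A v) (u - v) = -(A u (v - u)) - A v (u - v) := by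
    rw [← neg_sub u v, map_neg, sub_apply, neg_neg]
  have h6 : g (v - u) = -g (u - v) := by rw [← neg_sub u v, map_neg]
  rw [h5] at h1
  unfold vhiBifunction
  rw [h6]
  linarith

lemma convexOn_vhiBifunction (hj : LocallyLipschitz j) (g : StrongDual ℝ X) {u : X}
    (hψ : ConvexOn ℝ K (ψ u)) : ConvexOn ℝ K (vhiBifunction γ A ψ j g u) := by
  refine ⟨hψ.1, fun v hv w hw a b ha hb hab => ?_⟩
  have h1 := hψ.2 hv hw ha hb hab
  have h2 := (convexOn_clarkeDeriv hj (γ u)).2 (mem_univ (γ v - γ u)) (mem_univ (γ w - γ u))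
    ha hb hab
  obtain rfl : a = 1 - b := by linarith
  have e1 : (1 - b) • v + b • w - u = (1 - b) • (v - u) + b • (w - u) := by module
  have e2 : γ ((1 - b) • v + b • w) - γ u = (1 - b) • (γ v - γ u) + b • (γ w - γ u) := by
    rw [← map_sub, e1]; simp
  unfold vhiBifunction
  rw [e2, e1]
  simp only [map_add, map_smul, smul_eq_mul] at h1 h2 ⊢
  linarith

lemma lowerSemicontinuousOn_vhiBifunction (hj : LocallyLipschitz j) (g : StrongDual ℝ X) {u : X}
    (hψ : LowerSemicontinuousOn (ψ u) K) :
    LowerSemicontinuousOn (vhiBifunction γ A ψ j g u) K := by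
  have h1 : Continuous fun v =>
      A u (v - u) - ψ u u + clarkeDeriv j (γ u) (γ v - γ u) - g (v - u) := by
    have := (continuous_clarkeDeriv hj (γ u)).comp
      (show Continuous fun v => γ v - γ u by fun_prop)
    simp only [Function.comp_def] at this
    fun_prop
  have h2 := hψ.add (h1.lowerSemicontinuous.lowerSemicontinuousOn K)
  have e : vhiBifunction γ A ψ j g u = fun v =>
      ψ u v + (A u (v - u) - ψ u u + clarkeDeriv j (γ u) (γ v - γ u) - g (v - u)) := by
    funext v; unfold vhiBifunction; ring
  rw [e]
  exact h2

/-- No continuity of `ψ` in its first argument is assumed: `hψ` bounds `ψ w v - ψ w w` by `ψ u v - ψ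
u w` plus a vanishing term, and lower semicontinuity controls `-ψ u w`. -/
lemma vhiBifunction_hemicontinuous (hK : Convex ℝ K) (hA : Continuous A)
    (hψlsc : ∀ u ∈ K, LowerSemicontinuousOn (ψ u) K)
    (hψ : ∀ u₁ ∈ K, ∀ u₂ ∈ K, ∀ v₁ ∈ K, ∀ v₂ ∈ K,
      ψ u₁ v₂ - ψ u₁ v₁ + ψ u₂ v₁ - ψ u₂ v₂ ≤ α * ‖u₁ - u₂‖ * ‖v₁ - v₂‖)
    (hj : LocallyLipschitz j) (g : StrongDual ℝ X) {u v : X} (hu : u ∈ K) (hv : v ∈ K) {a : ℝ}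
    (ha : vhiBifunction γ A ψ j g u v < a) :
    ∀ᶠ t in 𝓝[>] (0 : ℝ), vhiBifunction γ A ψ j g ((1 - t) • u + t • v) v < a := by
  let w : ℝ → X := fun t => (1 - t) • u + t • v
  have hwc : Continuous w := by fun_prop
  have hw0 : w 0 = u := by simp [w]
  have hwt : Tendsto w (𝓝[>] 0) (𝓝 u) := by
    have := hwc.tendsto 0
    rw [hw0] at this
    exact this.mono_left nhdsWithin_le_nhds
  have hmem : ∀ᶠ t in 𝓝[>] (0 : ℝ), t ∈ Ioo (0 : ℝ) 1 := Ioo_mem_nhdsGT zero_lt_one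
  have hwK : ∀ᶠ t in 𝓝[>] (0 : ℝ), w t ∈ K := hmem.mono fun t ht =>
    hK hu hv (sub_nonneg.2 ht.2.le) ht.1.le (by ring)
  obtain ⟨ε, hε, hεa⟩ : ∃ ε > 0, vhiBifunction γ A ψ j g u v + 2 * ε < a :=
    ⟨(a - vhiBifunction γ A ψ j g u v) / 3, by linarith, by linarith⟩
  have h1 : ∀ᶠ t in 𝓝[>] (0 : ℝ), ψ u u - ε < ψ u (w t) :=
    (tendsto_nhdsWithin_iff.2 ⟨hwt, hwK⟩).eventually
      (hψlsc u hu u hu (ψ u u - ε) (sub_lt_self _ hε))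
  have h2 : ∀ᶠ t in 𝓝[>] (0 : ℝ), clarkeDeriv j (γ (w t)) (γ v - γ u)
      < clarkeDeriv j (γ u) (γ v - γ u) + ε :=
    ((γ.continuous.tendsto u).comp hwt).eventually
      (upperSemicontinuous_clarkeDeriv hj (γ v - γ u) (γ u) _ (lt_add_of_pos_right _ hε))
  -- A continuous majorant for small `t > 0`; one `ε` comes from `ψ`, the other from the Clarke
  -- term.
  let H : ℝ → ℝ := fun t => A (w t) (v - w t) - g (v - w t) + ψ u v - (ψ u u - ε)
    + α * ‖w t - u‖ * ‖w t - v‖ + (1 - t) * (clarkeDeriv j (γ u) (γ v - γ u) + ε)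
  have hHc : Continuous H := by
    have : Continuous fun t => A (w t) (v - w t) := (hA.comp hwc).clm_apply (by fun_prop)
    fun_prop
  have hH0 : H 0 < a := by
    have : H 0 = vhiBifunction γ A ψ j g u v + 2 * ε := by
      simp only [H, hw0, vhiBifunction, sub_self, norm_zero]
      ring
    rwa [this]
  have h3 : ∀ᶠ t in 𝓝[>] (0 : ℝ), H t < a :=
    nhdsWithin_le_nhds ((hHc.tendsto 0).eventually (gt_mem_nhds hH0))
  filter_upwards [h1, h2, h3, hmem, hwK] with t h1 h2 h3 ht hwK
  change vhiBifunction γ A ψ j g (w t) v < a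
  refine lt_of_le_of_lt ?_ h3
  have h4 := hψ (w t) hwK u hu (w t) hwK v hv
  -- The moving direction is a multiple of a fixed one, so semicontinuity in the base point
  -- suffices.
  have e : γ v - γ (w t) = (1 - t) • (γ v - γ u) := by
    simp only [w, map_add, map_smul]; module
  have h5 := clarkeDeriv_smul_le hj (γ (w t)) (γ v - γ u) (sub_nonneg.2 ht.2.le)
  have h6 := mul_le_mul_of_nonneg_left h2.le (sub_nonneg.2 ht.2.le)
  unfold vhiBifunction
  rw [e]
  simp only [H]
  linarith

/-- Unique solvability of the variational-hemivariational inequality. -/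
theorem existsUnique_vhi (hX : IsReflexiveSpace X) (hK : IsClosed K) (hKc : Convex ℝ K)
    (hne : K.Nonempty) (hγ : ∀ v : X, ‖γ v‖ ≤ cj * ‖v‖) (hAc : Continuous A)
    (hA : ∀ v₁ v₂ : X, mA * ‖v₁ - v₂‖ ^ 2 ≤ (A v₁ - A v₂) (v₁ - v₂))
    (hψconvex : ∀ u ∈ K, ConvexOn ℝ K (ψ u))
    (hψlsc : ∀ u ∈ K, LowerSemicontinuousOn (ψ u) K)
    (hψ : ∀ u₁ ∈ K, ∀ u₂ ∈ K, ∀ v₁ ∈ K, ∀ v₂ ∈ K,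
      ψ u₁ v₂ - ψ u₁ v₁ + ψ u₂ v₁ - ψ u₂ v₂ ≤ α * ‖u₁ - u₂‖ * ‖v₁ - v₂‖)
    (hjLip : LocallyLipschitz j) (hαj : 0 ≤ αj)
    (hj : ∀ z₁ z₂ : Xj,
      clarkeDeriv j z₁ (z₂ - z₁) + clarkeDeriv j z₂ (z₁ - z₂) ≤ αj * ‖z₁ - z₂‖ ^ 2)
    (hsmall : α + αj * cj ^ 2 < mA) (g : StrongDual ℝ X) :
    ∃! u, u ∈ K ∧ ∀ v ∈ K,
      g (v - u) ≤ A u (v - u) + ψ u v - ψ u u + clarkeDeriv j (γ u) (γ v - γ u) := by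
  have hmono {u v : X} (hu : u ∈ K) (hv : v ∈ K) :=
    vhiBifunction_strongly_monotone hγ hA hψ hαj hj g hu hv
  have hc := sub_pos.2 hsmall
  obtain ⟨u, hu, h⟩ := hX.exists_equilibrium hK hne hc
    (fun u _ => vhiBifunction_self hjLip g u) (fun u hu v hv => hmono hu hv)
    (fun u hu => convexOn_vhiBifunction hjLip g (hψconvex u hu))
    (fun u hu => lowerSemicontinuousOn_vhiBifunction hjLip g (hψlsc u hu))
    (fun u hu v hv a => vhiBifunction_hemicontinuous hKc hAc hψlsc hψ hjLip g hu hv)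
  refine ⟨u, ⟨hu, fun v hv => sub_nonneg.1 (h v hv)⟩, ?_⟩
  rintro w ⟨hw, hwv⟩
  have h1 := h w hw
  have h2 : 0 ≤ vhiBifunction γ A ψ j g w u := sub_nonneg.2 (hwv u hu)
  have h3 := hmono hu hw
  have h4 : ‖u - w‖ ^ 2 ≤ 0 := by
    by_contra! h5
    have := mul_pos hc h5
    linarith
  have h5 : ‖u - w‖ = 0 := pow_eq_zero_iff two_ne_zero |>.1 (le_antisymm h4 (sq_nonneg _))
  exact (sub_eq_zero.1 (norm_eq_zero.1 h5)).symm

end VariationalHemivariational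

/-! ### Time stepping -/

/-- A recursion in which the value at `n` is determined by the values before `n` has exactly one
solution. -/
lemma existsUnique_forall_eq_of_causal {ι β : Type*} [Preorder ι] [WellFoundedLT ι] [Inhabited β]
    (G : ι → (ι → β) → β) (hG : ∀ n u w, (∀ i < n, u i = w i) → G n u = G n w) :
    ∃! u : ι → β, ∀ n, u n = G n u := by
  classical
  let u : ι → β := (wellFounded_lt (α := ι)).fix fun n r =>
    G n fun i => if h : i < n then r i h else default
  have hu (n : ι) : u n = G n u := by
    have h1 : u n = G n fun i => if i < n then u i else default := by
      simp only [u]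
      rw [WellFounded.fix_eq]
      simp only [dite_eq_ite]
    rw [h1]
    exact hG _ _ _ fun i hi => if_pos hi
  refine ⟨u, hu, fun w hw => funext fun n => ?_⟩
  induction n using (wellFounded_lt (α := ι)).induction with
  | h n ih => rw [hw n, hu n, hG n w u ih]

lemma historyApprox_congr {X Y : Type*} [NormedAddCommGroup X] [NormedSpace ℝ X]
    [NormedAddCommGroup Y] [NormedSpace ℝ Y] (R : X →L[ℝ] Y) (q : C(ℝ≥0 × ℝ≥0, X →L[ℝ] X))
    (aS : X) (T : ℝ≥0) (N : ℕ) {n : Fin (N + 1)} {u w : Fin (N + 1) → X}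
    (h : ∀ i < n, u i = w i) :
    historyApprox R q aS T N n u = historyApprox R q aS T N n w := by
  unfold historyApprox
  split_ifs with hn
  · rfl
  · have h0 := h 0 (Fin.pos_of_ne_zero hn)
    -- Subtraction in `Fin` wraps around at `0`; `n ≠ 0` ensures `n - 1 < n`.
    have h1 := h (n - 1) (Fin.sub_one_lt_iff.2 (Fin.pos_of_ne_zero hn))
    have h2 : ∑ i ∈ Finset.Ioo 0 n, q (timeNode T N n, timeNode T N i) (u i)
        = ∑ i ∈ Finset.Ioo 0 n, q (timeNode T N n, timeNode T N i) (w i) :=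
      Finset.sum_congr rfl fun i hi => by rw [h i (Finset.mem_Ioo.1 hi).2]
    rw [h0, h1, h2]

/-- Unique solvability of the second-order semi-discrete scheme, for every final time `T ≥ 0` and
every number `N ≥ 1` of time steps. The function `φ` is given on `Y × K × K`; it is represented by
a function on `Y × X × X` of which only the values on `Y × K × K` are used. -/
theorem mainTheorem9 {X Xj Y : Type*}
    [NormedAddCommGroup X] [NormedSpace ℝ X] [CompleteSpace X]
    [NormedAddCommGroup Xj] [NormedSpace ℝ Xj] [CompleteSpace Xj]
    [NormedAddCommGroup Y] [NormedSpace ℝ Y]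
    (hX : IsReflexiveSpace X)
    (K : Set X) (hKclosed : IsClosed K) (hKconvex : Convex ℝ K) (hK0 : (0 : X) ∈ K)
    (γ : X →L[ℝ] Xj) (cj : ℝ) (hcj : 0 < cj) (hγ : ∀ v : X, ‖γ v‖ ≤ cj * ‖v‖)
    (A : X → StrongDual ℝ X)
    (LA : ℝ≥0) (hLA : 0 < LA) (hALip : LipschitzWith LA A)
    (mA : ℝ) (hmA : 0 < mA)
    (hAmono : ∀ v₁ v₂ : X, mA * ‖v₁ - v₂‖ ^ 2 ≤ (A v₁ - A v₂) (v₁ - v₂))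
    (φ : Y → X → X → ℝ)
    (hφconvex : ∀ y : Y, ∀ u ∈ K, ConvexOn ℝ K (φ y u))
    (hφlsc : ∀ y : Y, ∀ u ∈ K, LowerSemicontinuousOn (φ y u) K)
    (αφ βφ : ℝ) (hαφ : 0 < αφ) (hβφ : 0 < βφ)
    (hφ : ∀ y₁ y₂ : Y, ∀ u₁ ∈ K, ∀ u₂ ∈ K, ∀ v₁ ∈ K, ∀ v₂ ∈ K,
      φ y₁ u₁ v₂ - φ y₁ u₁ v₁ + φ y₂ u₂ v₁ - φ y₂ u₂ v₂
        ≤ αφ * ‖u₁ - u₂‖ * ‖v₁ - v₂‖ + βφ * ‖y₁ - y₂‖ * ‖v₁ - v₂‖)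
    (R : X →L[ℝ] Y) (q : C(ℝ≥0 × ℝ≥0, X →L[ℝ] X)) (aS : X)
    (j : Xj → ℝ) (hjLip : LocallyLipschitz j)
    (c₀ c₁ : ℝ) (hc₀ : 0 ≤ c₀) (hc₁ : 0 ≤ c₁)
    (hjgrowth : ∀ z : Xj, ∀ ξ ∈ clarkeSubdiff j z, ‖ξ‖ ≤ c₀ + c₁ * ‖z‖)
    (αj : ℝ) (hαj : 0 < αj)
    (hj : ∀ z₁ z₂ : Xj,
      clarkeDeriv j z₁ (z₂ - z₁) + clarkeDeriv j z₂ (z₁ - z₂) ≤ αj * ‖z₁ - z₂‖ ^ 2)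
    (f : C(ℝ≥0, StrongDual ℝ X))
    (hsmall : αφ + αj * cj ^ 2 < mA)
    (T : ℝ≥0) (N : ℕ) (hN : 0 < N) :
    ∃! u : Fin (N + 1) → X, IsSemiDiscreteSolution K γ A φ j f R q aS T N u := by
  -- With `y` frozen in both slots of `hφ`, the `βφ` term vanishes.
  have step (y : Y) (g : StrongDual ℝ X) := existsUnique_vhi (ψ := φ y) (α := αφ) hX hKclosed
    hKconvex ⟨0, hK0⟩ hγ hALip.continuous hAmono (hφconvex y) (hφlsc y)
    (fun u₁ hu₁ u₂ hu₂ v₁ hv₁ v₂ hv₂ => by simpa using hφ y y u₁ hu₁ u₂ hu₂ v₁ hv₁ v₂ hv₂)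
    hjLip hαj.le hj hsmall g
  choose s hs hsu using step
  have : Inhabited X := ⟨0⟩
  have key (u : Fin (N + 1) → X) : IsSemiDiscreteSolution K γ A φ j f R q aS T N u ↔
      ∀ n, u n = s (historyApprox R q aS T N n u) (f (timeNode T N n)) := by
    refine forall_congr' fun n => ⟨fun h => hsu _ _ _ h, fun h => ?_⟩
    have h' := hs (historyApprox R q aS T N n u) (f (timeNode T N n))
    rw [← h] at h'
    exact h'
  simp only [key]
  exact existsUnique_forall_eq_of_causal
    (fun n u => s (historyApprox R q aS T N n u) (f (timeNode T N n)))
    fun n u w h => by rw [historyApprox_congr R q aS T N h]
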